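/- Let $K$ be a field of characteristic zero, $n\ge 1$, and $P_n=K[x_1,\dots,x_n]$. Let $D_n={\rm Der}_K(P_n)$ be the Lie algebra of $K$-derivations of $P_n$ with the bracket $[\partial,\delta]=\partial\delta-\delta\partial$; every $\partial\in D_n$ is uniquely $\partial=\sum_{i=1}^n a_i\frac{\partial}{\partial x_i}$ with $a_i\in P_n$, and its divergence is ${\rm div}(\partial)=\sum_{i=1}^n\frac{\partial a_i}{\partial x_i}$. Let $\mathfrak{div}_n^0=\{\partial\in D_n : {\rm div}(\partial)=0\}$, a Lie subalgebra of $D_n$, let $\mathbf{G}_n={\rm Aut}_{\rm Lie}(\mathfrak{div}_n^0)$ be the group of its ($K$-linear) Lie algebra automorphisms, and let $G_n={\rm Aut}_{K\text{-alg}}(P_n)$. Let ${\rm Sh}_1=\{\sigma\in G_1 : \sigma(x_1)=x_1+\lambda \text{ for some } \lambda\in K\}$. 1. If $n\ge 2$, then for every $\sigma\in G_n$ and $\partial\in\mathfrak{div}_n^0$ the derivation $\sigma\partial\sigma^{-1}$ lies in $\mathfrak{div}_n^0$, and the map $G_n\to\mathbf{G}_n$, $\sigma\mapsto(\partial\mapsto\sigma\partial\sigma^{-1})$,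 is an isomorphism of groups. 2. If $n=1$, then ${\rm Sh}_1$ is a normal subgroup of $G_1$, the rule $\sigma\mapsto(\partial\mapsto\sigma\partial\sigma^{-1})$ induces a well-defined isomorphism of groups $G_1/{\rm Sh}_1\to\mathbf{G}_1$, and $G_1/{\rm Sh}_1\simeq K^*$, the multiplicative group of $K$. -/

import Mathlib

/-- The automorphisms of a Lie algebra form a group under composition. -/
instance LieEquiv.instGroupAut {K L : Type*} [CommRing K] [LieRing L] [LieAlgebra K L] :
    Group (L ≃ₗ⁅K⁆ L) where
  one := 1
  mul f g := g.trans f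
  inv f := f.symm
  mul_assoc _ _ _ := rfl
  one_mul _ := rfl
  mul_one _ := rfl
  inv_mul_cancel f := DFunLike.ext _ _ fun x => f.symm_apply_apply x

namespace PolyVect

/-- The group of automorphisms of a Lie algebra. -/
abbrev LieAut (K L : Type*) [CommRing K] [LieRing L] [LieAlgebra K L] : Type _ := L ≃ₗ⁅K⁆ L

variable (K : Type*) [Field K] (n : ℕ)

/-- The polynomial algebra in `n` variables over `K`. -/
abbrev P : Type _ := MvPolynomial (Fin n) K

/-- The group of `K`-algebra automorphisms of the polynomial algebra. -/
abbrev G : Type _ := P K n ≃ₐ[K] P K n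

/-- The Lie algebra of polynomial vector fields: the `K`-derivations of the polynomial algebra,
with the commutator bracket. -/
abbrev D : Type _ := Derivation K (P K n) (P K n)

variable {K n}

/-- The divergence: a derivation `∂ = ∑ aᵢ ∂ᵢ` has coefficients `aᵢ = ∂ (xᵢ)`, and its divergence
is `∑ ∂ aᵢ / ∂ xᵢ`. -/
noncomputable def divergence (d : D K n) : P K n :=
  ∑ i, MvPolynomial.pderiv i (d (MvPolynomial.X i))

/-- Coordinate expression of a derivation. -/
theorem apply_eq_sum (d : D K n) (p : P K n) :
    d p = ∑ j, d (MvPolynomial.X j) * MvPolynomial.pderiv j p := by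
  have h : d = ∑ j, d (MvPolynomial.X j) • (MvPolynomial.pderiv j : D K n) := by
    refine MvPolynomial.derivation_ext fun i => ?_
    rw [← Derivation.coeFnAddMonoidHom_apply, ← Derivation.coeFnAddMonoidHom_apply, map_sum,
      Finset.sum_apply]
    simp [MvPolynomial.pderiv_X, Pi.single_apply]
  conv_lhs => rw [h]
  rw [← Derivation.coeFnAddMonoidHom_apply, map_sum, Finset.sum_apply]
  simp

/-- The partial derivatives commute. -/
theorem pderiv_comm (i j : Fin n) (p : P K n) :
    MvPolynomial.pderiv i (MvPolynomial.pderiv j p)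
      = MvPolynomial.pderiv j (MvPolynomial.pderiv i p) := by
  have h : ⁅(MvPolynomial.pderiv i : D K n), (MvPolynomial.pderiv j : D K n)⁆ = 0 := by
    refine MvPolynomial.derivation_ext fun k => ?_
    rw [Derivation.commutator_apply]
    simp only [MvPolynomial.pderiv_X, Pi.single_apply, Derivation.zero_apply]
    split_ifs <;> simp
  have h2 := congrArg (fun d : D K n => d p) h
  simpa [Derivation.commutator_apply, sub_eq_zero] using h2

/-- `div [d, e] = d (div e) - e (div d)`. -/
theorem divergence_lie (d e : D K n) :
    divergence ⁅d, e⁆ = d (divergence e) - e (divergence d) := by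
  have key : ∀ d e : D K n, ∑ i, MvPolynomial.pderiv i (d (e (MvPolynomial.X i)))
      = d (divergence e) + ∑ i, ∑ j, MvPolynomial.pderiv i (d (MvPolynomial.X j))
          * MvPolynomial.pderiv j (e (MvPolynomial.X i)) := by
    intro d e
    rw [divergence, map_sum, ← Finset.sum_add_distrib]
    refine Finset.sum_congr rfl fun i _ => ?_
    rw [apply_eq_sum d (e (MvPolynomial.X i)),
      apply_eq_sum d (MvPolynomial.pderiv i (e (MvPolynomial.X i))), map_sum,
      ← Finset.sum_add_distrib]
    refine Finset.sum_congr rfl fun j _ => ?_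
    rw [MvPolynomial.pderiv_mul, pderiv_comm i j]
    ring
  have h : divergence ⁅d, e⁆ = ∑ i, MvPolynomial.pderiv i (d (e (MvPolynomial.X i)))
      - ∑ i, MvPolynomial.pderiv i (e (d (MvPolynomial.X i))) := by
    simp [divergence, Derivation.commutator_apply]
  rw [h, key d e, key e d, Finset.sum_comm]
  simp only [mul_comm]
  ring

variable (K n)

/-- The Lie algebra of polynomial vector fields with zero divergence. -/
noncomputable def divZero : LieSubalgebra K (D K n) where
  carrier := {d | divergence d = 0}
  zero_mem' := by simp [divergence]
  add_mem' {a b} ha hb := by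
    simp only [Set.mem_ofPred_eq, divergence, Derivation.add_apply, map_add,
      Finset.sum_add_distrib] at *
    rw [ha, hb, add_zero]
  smul_mem' c a ha := by
    simp only [Set.mem_ofPred_eq, divergence, Derivation.smul_apply, Derivation.map_smul,
      ← Finset.smul_sum] at *
    rw [ha, smul_zero]
  lie_mem' {a b} ha hb := by
    simp only [Set.mem_ofPred_eq] at *
    change divergence a = 0 at ha
    change divergence b = 0 at hb
    change divergence ⁅a, b⁆ = 0
    rw [divergence_lie, ha, hb, map_zero, map_zero, sub_zero]

/-- The shift group: the automorphisms `xᵢ ↦ xᵢ + cᵢ` with `c ∈ Kⁿ`. -/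
noncomputable def Sh : Subgroup (G K n) where
  carrier := {s | ∃ c : Fin n → K, ∀ i,
    s (MvPolynomial.X i) = MvPolynomial.X i + MvPolynomial.C (c i)}
  one_mem' := ⟨0, fun i => by simp⟩
  mul_mem' := by
    rintro s t ⟨a, ha⟩ ⟨b, hb⟩
    refine ⟨a + b, fun i => ?_⟩
    rw [AlgEquiv.mul_apply, hb, map_add, ha, ← MvPolynomial.algebraMap_eq, AlgEquiv.commutes,
      Pi.add_apply, map_add, add_assoc]
  inv_mem' := by
    rintro s ⟨a, ha⟩
    refine ⟨-a, fun i => ?_⟩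
    apply s.injective
    have h : s (s⁻¹ (MvPolynomial.X i)) = MvPolynomial.X i := s.apply_symm_apply _
    rw [h, map_add, ha, ← MvPolynomial.algebraMap_eq, AlgEquiv.commutes, Pi.neg_apply, map_neg]
    ring

end PolyVect

namespace PolyVect

open MvPolynomial

variable {K : Type*} [Field K] {n : ℕ}

/-! Let n ≥ 2, let φ be an automorphism and e_i = φ(∂_i). The plan is to straighten the e_i to the
∂_i by a conjugation, and then to show that what remains is the identity. The e_i commute. As ad ∂_i
is locally nilpotent, so is ad e_i on divergence-free fields, and testing it on x_i^k ∂_j for all k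
makes e_i locally nilpotent (`isLocNilp_of_ad`). If all e_i kill a, then the fields a^k e_1 are
divergence-free and commute with every e_i, so they lie in the finite-dimensional φ-image of the
constant fields; by degree a is constant (`exists_eq_C_of_map_vf_one`). The images of the shears x_i
∂_j turn one suitable polynomial into coordinates dual to the e_i (`exists_dual`), and such
coordinates define an automorphism of the polynomial ring (`exists_conjD_pderiv_eq`). Translating
them makes the conjugation agree with φ on a diagonal field as well (`exists_conj_eq`). An
automorphism fixing all ∂_i and a generic diagonal field fixes x^m ∂_j for m_j = 0, by induction on
degree: the error commutes with each ∂_k, so it is a constant field, and brackets with fixed fields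
kill it. These fields generate the Lie algebra (`eq_one_of_fixed`). For n = 1 the Lie algebra is the
line K∂, so its automorphisms are the nonzero scalars; scalings realise them and shifts are the
kernel. -/

/-! ### Partial derivatives: kernel, integration, local nilpotency. -/

theorem eq_C_of_pderiv_eq_zero [CharZero K] {p : P K n} (h : ∀ i, pderiv i p = 0) :
    p = C (coeff 0 p) := by
  ext m
  rw [coeff_C]
  split_ifs with hm
  · rw [hm]
  · obtain ⟨i, hi⟩ : ∃ i, m i ≠ 0 := by
      by_contra! hc
      exact hm (Finsupp.ext fun i => (hc i).symm)
    have h1 := congrArg (coeff (m - Finsupp.single i 1)) (h i)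
    have h2 : m - Finsupp.single i 1 + Finsupp.single i 1 = m :=
      tsub_add_cancel_of_le (Finsupp.single_le_iff.2 (Nat.one_le_iff_ne_zero.2 hi))
    rw [coeff_pderiv, h2, coeff_zero] at h1
    refine (mul_eq_zero.1 h1).resolve_right ?_
    exact Nat.cast_add_one_ne_zero _

/-- Termwise integration of a polynomial in the variable `x_i`. -/
noncomputable def antideriv (i : Fin n) : P K n →ₗ[K] P K n :=
  (basisMonomials (Fin n) K).constr K
    fun m => monomial (m + Finsupp.single i 1) ((m i : K) + 1)⁻¹

theorem antideriv_monomial (i : Fin n) (m : Fin n →₀ ℕ) (c : K) :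
    antideriv i (monomial m c) = monomial (m + Finsupp.single i 1) (c * ((m i : K) + 1)⁻¹) := by
  have h : (monomial m c : P K n) = c • basisMonomials (Fin n) K m := by
    simp [smul_monomial]
  rw [h, map_smul, antideriv, Module.Basis.constr_basis, smul_monomial, smul_eq_mul]

theorem pderiv_antideriv_self [CharZero K] (i : Fin n) (p : P K n) :
    pderiv i (antideriv i p) = p := by
  induction p using MvPolynomial.induction_on' with
  | monomial m c =>
    have h : (m i : K) + 1 ≠ 0 := by exact Nat.cast_add_one_ne_zero (m i)
    rw [antideriv_monomial, pderiv_monomial]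
    simp [h]
  | add p q hp hq => rw [map_add, map_add, hp, hq]

theorem pderiv_antideriv_of_ne {i j : Fin n} (hij : i ≠ j) (p : P K n) :
    pderiv j (antideriv i p) = antideriv i (pderiv j p) := by
  induction p using MvPolynomial.induction_on' with
  | monomial m c =>
    rw [antideriv_monomial, pderiv_monomial, pderiv_monomial, antideriv_monomial]
    have h1 : (m + Finsupp.single i 1 : Fin n →₀ ℕ) j = m j := by simp [hij]
    have h2 : (m - Finsupp.single j 1 : Fin n →₀ ℕ) i = m i := by simp [hij.symm]
    rw [h1, h2]
    rcases Nat.eq_zero_or_pos (m j) with h0 | h0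
    · simp [h0]
    · have h3 : Finsupp.single j 1 ≤ m := Finsupp.single_le_iff.2 h0
      rw [tsub_add_eq_add_tsub h3]
      congr 1
      ring
  | add p q hp hq => simp only [map_add, hp, hq]

/-- A derivation of the polynomial algebra is locally nilpotent when each polynomial is
annihilated by some power of it. -/
def IsLocNilp (d : D K n) : Prop := ∀ p, ∃ N : ℕ, d^[N] p = 0

theorem iterate_map_zero (d : D K n) (N : ℕ) : d^[N] 0 = 0 :=
  Function.iterate_fixed (map_zero d) N

theorem iterate_eq_zero_of_le (d : D K n) {p : P K n} {M N : ℕ} (h : M ≤ N)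
    (hM : d^[M] p = 0) : d^[N] p = 0 := by
  obtain ⟨k, rfl⟩ := Nat.exists_eq_add_of_le h
  rw [add_comm, Function.iterate_add_apply, hM, iterate_map_zero]

theorem iterate_map_add (d : D K n) (N : ℕ) (p q : P K n) :
    d^[N] (p + q) = d^[N] p + d^[N] q := by
  induction N generalizing p q with
  | zero => rfl
  | succ N ih => rw [Function.iterate_succ_apply, map_add, ih]; rfl

theorem isLocNilp_pderiv (i : Fin n) : IsLocNilp (pderiv i : D K n) := by
  intro p
  induction p using MvPolynomial.induction_on' with
  | monomial m c =>
    induction h : m i generalizing m c with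
    | zero => exact ⟨1, by simp [pderiv_monomial, h]⟩
    | succ k ih =>
      obtain ⟨N, hN⟩ := ih (m - Finsupp.single i 1) (c * m i) (by simp [h])
      exact ⟨N + 1, by rw [Function.iterate_succ_apply, pderiv_monomial, hN]⟩
  | add p q hp hq =>
    obtain ⟨M, hM⟩ := hp
    obtain ⟨N, hN⟩ := hq
    refine ⟨M + N, ?_⟩
    rw [iterate_map_add, iterate_eq_zero_of_le _ (Nat.le_add_right M N) hM,
      iterate_eq_zero_of_le _ (Nat.le_add_left N M) hN, add_zero]

/-! ### Jacobi's formula and the divergence of commuting fields. -/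

theorem derivation_prod {ι A : Type*} [DecidableEq ι] [CommRing A] [Algebra K A]
    (d : Derivation K A A) (s : Finset ι) (f : ι → A) :
    d (∏ i ∈ s, f i) = ∑ i ∈ s, d (f i) * ∏ j ∈ s.erase i, f j := by
  induction s using Finset.induction_on with
  | empty => simp
  | insert a s ha ih =>
    rw [Finset.prod_insert ha, d.leibniz, ih, Finset.sum_insert ha, Finset.erase_insert ha,
      smul_eq_mul, smul_eq_mul, add_comm, mul_comm, Finset.mul_sum]
    congr 1
    refine Finset.sum_congr rfl fun i hi => ?_
    have hia : a ≠ i := fun h => ha (h ▸ hi)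
    rw [Finset.erase_insert_of_ne hia, Finset.prod_insert (by simp [ha])]
    ring

/-- Jacobi's formula for the derivative of a determinant. -/
theorem derivation_det {ι A : Type*} [Fintype ι] [DecidableEq ι] [CommRing A] [Algebra K A]
    (d : Derivation K A A) (M : Matrix ι ι A) :
    d M.det = ∑ i, ∑ k, M.adjugate i k * d (M k i) := by
  have h : ∀ i, ∑ k, M.adjugate i k * d (M k i) = (M.updateCol i fun k => d (M k i)).det := by
    intro i
    rw [← Matrix.cramer_apply, Matrix.cramer_eq_adjugate_mulVec]
    rfl
  simp only [h]
  simp only [Matrix.det_apply, map_sum, Units.smul_def, map_zsmul, derivation_prod]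
  rw [Finset.sum_comm]
  refine Finset.sum_congr rfl fun s _ => ?_
  rw [← Finset.smul_sum]
  congr 1
  refine Finset.sum_congr rfl fun i _ => ?_
  rw [← Finset.mul_prod_erase _ _ (Finset.mem_univ i), Matrix.updateCol_self]
  congr 1
  refine Finset.prod_congr rfl fun j hj => ?_
  rw [Matrix.updateCol_ne (Finset.ne_of_mem_erase hj)]

theorem derivation_eq_zero_of_isUnit (d : D K n) {p : P K n} (hp : IsUnit p) : d p = 0 := by
  rw [totalDegree_eq_zero_iff_eq_C.1 (isUnit_iff_totalDegree_of_isReduced.1 hp).2, derivation_C]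

theorem sum_pderiv_mul_dual {e : Fin n → D K n} {y : Fin n → P K n}
    (h : ∀ i j, e i (y j) = if i = j then 1 else 0) :
    (Matrix.of fun i k => e i (X k)) * (Matrix.of fun k j => pderiv k (y j)) = 1 := by
  ext1 i j
  simp only [Matrix.mul_apply, Matrix.of_apply, Matrix.one_apply]
  rw [← apply_eq_sum, h]

/-- Commuting derivations that admit dual coordinates have zero divergence. -/
theorem divergence_eq_zero_of_dual {e : Fin n → D K n} {y : Fin n → P K n}
    (h : ∀ i j, e i (y j) = if i = j then 1 else 0)
    (hc : ∀ i j p, e i (e j p) = e j (e i p)) (m : Fin n) : divergence (e m) = 0 := by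
  set A : Matrix (Fin n) (Fin n) (P K n) := Matrix.of fun i k => e i (X k) with hA
  set B : Matrix (Fin n) (Fin n) (P K n) := Matrix.of fun k j => pderiv k (y j) with hB
  have hAB : A * B = 1 := sum_pderiv_mul_dual h
  have hBA : B * A = 1 := mul_eq_one_comm.1 hAB
  have hadj : A.adjugate = A.det • B := by
    rw [← Matrix.mul_one A.adjugate, ← hAB, ← Matrix.mul_assoc, Matrix.adjugate_mul,
      Matrix.smul_mul, Matrix.one_mul]
  have hu : IsUnit A.det := (Matrix.isUnit_iff_isUnit_det A).1 (IsUnit.of_mul_eq_one B hAB)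
  have hpd : ∀ k : Fin n, (pderiv k : D K n) = ∑ j, pderiv k (y j) • e j := by
    intro k
    refine derivation_ext fun l => ?_
    rw [← Derivation.coeFnAddMonoidHom_apply, ← Derivation.coeFnAddMonoidHom_apply, map_sum,
      Finset.sum_apply]
    simp only [Derivation.coeFnAddMonoidHom_apply, Derivation.smul_apply, smul_eq_mul]
    have := congrFun (congrFun hBA k) l
    simp only [Matrix.mul_apply, hA, hB, Matrix.of_apply, Matrix.one_apply] at this
    rw [this, pderiv_X, Pi.single_apply]
    simp only [eq_comm]
  have hpd' : ∀ (k : Fin n) (p : P K n), pderiv k p = ∑ j, B k j * e j p := by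
    intro k p
    conv_lhs => rw [hpd k]
    rw [← Derivation.coeFnAddMonoidHom_apply, map_sum, Finset.sum_apply]
    rfl
  -- The determinant is a unit, hence a constant killed by `e m`; Jacobi's formula and commutation
  -- turn its derivative into det A times the divergence.
  have hdet : A.det * divergence (e m) = 0 := by
    rw [← derivation_eq_zero_of_isUnit (e m) hu, derivation_det, divergence, Finset.mul_sum]
    refine Finset.sum_congr rfl fun i _ => ?_
    rw [hpd', Finset.mul_sum]
    refine Finset.sum_congr rfl fun k _ => ?_
    rw [hadj, Matrix.smul_apply, smul_eq_mul, mul_assoc, hA, Matrix.of_apply, hc]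
  exact hu.mul_right_eq_zero.1 hdet

/-! ### Conjugation and divergence. -/

/-- The conjugate `σ d σ⁻¹` of a derivation by an automorphism. -/
noncomputable def conjD (σ : G K n) (d : D K n) : D K n :=
  Derivation.mk' (σ.toLinearMap ∘ₗ (d : P K n →ₗ[K] P K n) ∘ₗ (σ⁻¹ : G K n).toLinearMap)
    fun a b => by
      simp

@[simp]
theorem conjD_apply (σ : G K n) (d : D K n) (p : P K n) : conjD σ d p = σ (d (σ⁻¹ p)) := rfl

theorem conjD_apply_map (σ : G K n) (d : D K n) (p : P K n) : conjD σ d (σ p) = σ (d p) := by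
  have h : σ⁻¹ (σ p) = p := σ.symm_apply_apply p
  rw [conjD_apply, h]

theorem conjD_mul (σ τ : G K n) (d : D K n) : conjD (σ * τ) d = conjD σ (conjD τ d) := by
  refine Derivation.ext fun p => ?_
  simp [mul_inv_rev]

theorem conjD_one (d : D K n) : conjD 1 d = d := by
  refine Derivation.ext fun p => ?_
  simp

theorem conjD_inv_conjD (σ : G K n) (d : D K n) : conjD σ⁻¹ (conjD σ d) = d := by
  rw [← conjD_mul, inv_mul_cancel, conjD_one]

theorem conjD_conjD_inv (σ : G K n) (d : D K n) : conjD σ (conjD σ⁻¹ d) = d := by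
  rw [← conjD_mul, mul_inv_cancel, conjD_one]

theorem conjD_lie (σ : G K n) (d e : D K n) : conjD σ ⁅d, e⁆ = ⁅conjD σ d, conjD σ e⁆ := by
  refine Derivation.ext fun p => ?_
  have h : ∀ c, σ⁻¹ (σ c) = c := σ.symm_apply_apply
  simp [Derivation.commutator_apply, h]

theorem divergence_conjD_pderiv (σ : G K n) (i : Fin n) :
    divergence (conjD σ (pderiv i)) = 0 := by
  refine divergence_eq_zero_of_dual (e := fun i => conjD σ (pderiv i))
    (y := fun j => σ (X j)) (fun i j => ?_) (fun i j p => ?_) i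
  · rw [conjD_apply_map, pderiv_X, Pi.single_apply]
    split_ifs <;> simp_all
  · have h : ∀ c, σ⁻¹ (σ c) = c := σ.symm_apply_apply
    simp only [conjD_apply, h]
    rw [pderiv_comm]

/-- With d = ∑ a_i ∂_i, the conjugate is ∑ σ(a_i) σ∂_iσ⁻¹. The fields σ∂_iσ⁻¹ are divergence-free,
so only the derivatives of the coefficients contribute. -/
theorem divergence_conjD (σ : G K n) (d : D K n) :
    divergence (conjD σ d) = σ (divergence d) := by
  have hσ : ∀ c, σ⁻¹ (σ c) = c := σ.symm_apply_apply
  have h : ∀ k, conjD σ d (X k) = ∑ i, σ (d (X i)) * conjD σ (pderiv i) (X k) := by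
    intro k
    rw [conjD_apply, apply_eq_sum d, map_sum]
    simp
  have h2 : ∀ q : P K n, ∀ i, σ (pderiv i q) = conjD σ (pderiv i) (σ q) :=
    fun q i => (conjD_apply_map σ _ q).symm
  have h3 : ∀ i, ∑ k, pderiv k (conjD σ (pderiv i) (X k)) = 0 := divergence_conjD_pderiv σ
  rw [divergence, divergence, map_sum]
  simp only [h, h2, map_sum, pderiv_mul]
  rw [Finset.sum_comm]
  refine Finset.sum_congr rfl fun i _ => ?_
  rw [Finset.sum_add_distrib, ← Finset.mul_sum, h3, mul_zero, add_zero,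
    apply_eq_sum (conjD σ (pderiv i)) (σ (d (X i)))]
  exact Finset.sum_congr rfl fun k _ => mul_comm _ _

theorem mem_divZero {d : D K n} : d ∈ divZero K n ↔ divergence d = 0 := Iff.rfl

theorem conjD_mem (σ : G K n) (d : divZero K n) : conjD σ (d : D K n) ∈ divZero K n := by
  rw [mem_divZero, divergence_conjD, mem_divZero.1 d.2, map_zero]

/-- Conjugation by automorphisms of the polynomial algebra, as automorphisms of the Lie algebra
of divergence-free vector fields. -/
noncomputable def conj (K : Type*) [Field K] (n : ℕ) : G K n →* LieAut K (divZero K n) where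
  toFun σ :=
    { toFun d := ⟨conjD σ d, conjD_mem σ d⟩
      invFun d := ⟨conjD σ⁻¹ d, conjD_mem σ⁻¹ d⟩
      map_add' d e := Subtype.ext <| Derivation.ext fun p => by simp
      map_smul' c d := Subtype.ext <| Derivation.ext fun p => by simp
      map_lie' {d e} := Subtype.ext <| by simp [conjD_lie]
      left_inv d := Subtype.ext <| conjD_inv_conjD σ d
      right_inv d := Subtype.ext <| conjD_conjD_inv σ d }
  map_one' := LieEquiv.ext fun d => Subtype.ext <| conjD_one d.1
  map_mul' σ τ := LieEquiv.ext fun d => Subtype.ext <| conjD_mul σ τ d.1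

theorem coe_conj (σ : G K n) (d : divZero K n) : (conj K n σ d : D K n) = conjD σ d := rfl

/-! ### From locally nilpotent adjoint action to locally nilpotent derivation. -/

/-- A power series over a factorial domain all of whose powers have a common polynomial
denominator is a polynomial. -/
theorem exists_polynomial_of_pow_mul {R : Type*} [CommRing R] [IsDomain R]
    [UniqueFactorizationMonoid R] {b : PowerSeries R} {g : Polynomial R} (hg : g ≠ 0)
    (h : ∀ k : ℕ, ∃ q : Polynomial R, b ^ k * (g : PowerSeries R) = q) :
    ∃ q : Polynomial R, b = q := by
  obtain ⟨f, hf⟩ := h 1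
  rw [pow_one] at hf
  have hinj : Function.Injective ((↑) : Polynomial R → PowerSeries R) :=
    Polynomial.coe_injective R
  have hg' : (g : PowerSeries R) ≠ 0 := fun h0 => hg (hinj (by simpa using h0))
  have hdvd : ∀ k, g ^ k ∣ f ^ k * g := by
    intro k
    obtain ⟨q, hq⟩ := h k
    refine ⟨q, hinj ?_⟩
    simp only [Polynomial.coe_mul, Polynomial.coe_pow]
    rw [← hf, ← hq]
    ring
  have hgf : g ∣ f := by
    rcases eq_or_ne f 0 with rfl | hf0
    · exact dvd_zero g
    rw [UniqueFactorizationMonoid.dvd_iff_emultiplicity_le hg]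
    intro p hp
    have hgm := (FiniteMultiplicity.of_prime_left hp hg).emultiplicity_eq_multiplicity
    have hfm := (FiniteMultiplicity.of_prime_left hp hf0).emultiplicity_eq_multiplicity
    -- With v the multiplicity of p, g^k ∣ f^k g gives k (v(g) - v(f)) ≤ v(g); the choice k = v(g) +
    -- 1 forces v(g) ≤ v(f).
    have hle := emultiplicity_le_emultiplicity_of_dvd_right (a := p)
      (hdvd (multiplicity p g + 1))
    rw [emultiplicity_mul hp, emultiplicity_pow hp, emultiplicity_pow hp] at hle
    rw [hgm, hfm] at hle ⊢
    norm_cast at hle ⊢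
    nlinarith
  obtain ⟨q, rfl⟩ := hgf
  refine ⟨q, mul_right_cancel₀ hg' ?_⟩
  rw [hf, Polynomial.coe_mul, mul_comm]

section Exponential

variable {A M : Type*} [CommRing A] [Algebra K A] [AddCommGroup M] [Module A M]

/-- Leibniz' rule for iterates of an operator on a module compatible with a derivation. -/
theorem iterate_smul_leibniz (d : Derivation K A A) (T : M →+ M)
    (hT : ∀ a m, T (a • m) = d a • m + a • T m) (k : ℕ) (a : A) (m : M) :
    T^[k] (a • m) = ∑ ij ∈ Finset.HasAntidiagonal.antidiagonal k,
      k.choose ij.1 • (d^[ij.1] a • T^[ij.2] m) := by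
  induction k with
  | zero => simp
  | succ k ih =>
    rw [Finset.sum_antidiagonal_choose_succ_nsmul (M := M) (fun i j => d^[i] a • T^[j] m) k]
    simp only [Function.iterate_succ_apply', ih, map_sum, map_nsmul, hT, smul_add,
      Finset.sum_add_distrib]
    rw [add_comm]
    congr 1
    refine Finset.sum_congr rfl fun ij hij => ?_
    rw [k.choose_symm_of_eq_add (Finset.HasAntidiagonal.mem_antidiagonal.1 hij).symm]

/-- The formal exponential `∑ tᵏ ℓ (Tᵏ m) / k!`. -/
noncomputable def expSeries (K : Type*) [Field K] [Algebra K A] (T : M →+ M) (l : M →ₗ[A] A)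
    (m : M) : PowerSeries A :=
  PowerSeries.mk fun k => ((k.factorial : K)⁻¹) • l (T^[k] m)

/-- Leibniz' rule exponentiates: exp(tT)(a m) = exp(td)(a) · exp(tT)(m), and `l` respects
multiplication by elements of `A`. -/
theorem expSeries_smul [CharZero K] (d : Derivation K A A) (T : M →+ M) (l : M →ₗ[A] A)
    (hT : ∀ a m, T (a • m) = d a • m + a • T m) (a : A) (m : M) :
    expSeries K T l (a • m)
      = expSeries K (d : A →+ A) LinearMap.id a * expSeries K T l m := by
  ext k
  rw [PowerSeries.coeff_mul]
  simp only [expSeries, PowerSeries.coeff_mk]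
  rw [iterate_smul_leibniz d T hT, map_sum, Finset.smul_sum]
  refine Finset.sum_congr rfl fun ij hij => ?_
  obtain ⟨i, j⟩ := ij
  obtain rfl : i + j = k := Finset.HasAntidiagonal.mem_antidiagonal.1 hij
  have hc : (((i + j).factorial : K)⁻¹) * ((i + j).choose i : K)
      = (i.factorial : K)⁻¹ * (j.factorial : K)⁻¹ := by
    have h1 := Nat.add_choose_mul_factorial_mul_factorial i j
    rw [← Nat.choose_symm_add] at h1
    have h2 : ((i + j).choose i : K) * i.factorial * j.factorial = (i + j).factorial := by
      exact_mod_cast h1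
    have hi : (i.factorial : K) ≠ 0 := Nat.cast_ne_zero.2 i.factorial_ne_zero
    have hj : (j.factorial : K) ≠ 0 := Nat.cast_ne_zero.2 j.factorial_ne_zero
    have hij : ((i + j).factorial : K) ≠ 0 := Nat.cast_ne_zero.2 (i + j).factorial_ne_zero
    field_simp
    linear_combination h2
  rw [map_nsmul, map_smul, ← Nat.cast_smul_eq_nsmul K, smul_smul, hc, smul_mul_smul_comm]
  rfl

theorem expSeries_pow_smul [CharZero K] (d : Derivation K A A) (T : M →+ M) (l : M →ₗ[A] A)
    (hT : ∀ a m, T (a • m) = d a • m + a • T m) (a : A) (m : M) (k : ℕ) :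
    expSeries K T l (a ^ k • m)
      = expSeries K (d : A →+ A) LinearMap.id a ^ k * expSeries K T l m := by
  induction k with
  | zero => simp
  | succ k ih => rw [pow_succ', mul_smul, expSeries_smul d T l hT, ih, pow_succ', mul_assoc]

theorem exists_polynomial_eq_mk {R : Type*} [CommRing R] {f : ℕ → R} {N : ℕ}
    (h : ∀ k, N ≤ k → f k = 0) : ∃ q : Polynomial R, PowerSeries.mk f = q := by
  refine ⟨(PowerSeries.mk f).trunc N, ?_⟩
  ext k
  rw [Polynomial.coeff_coe, PowerSeries.coeff_trunc, PowerSeries.coeff_mk]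
  split_ifs with hk
  · rfl
  · exact h k (not_lt.1 hk)

theorem expSeries_eq_polynomial {T : M →+ M} (l : M →ₗ[A] A) {m : M} {N : ℕ}
    (h : T^[N] m = 0) : ∃ q : Polynomial A, expSeries K T l m = q := by
  refine exists_polynomial_eq_mk (N := N) fun k hk => ?_
  obtain ⟨j, rfl⟩ := Nat.exists_eq_add_of_le hk
  rw [add_comm, Function.iterate_add_apply, h, Function.iterate_fixed (map_zero T), map_zero,
    smul_zero]

/-- If `aᵏ m` is annihilated by a power of `T` for every `k`, and `ℓ m ≠ 0`, then `a` is
annihilated by a power of `d`. -/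
theorem exists_iterate_eq_zero_of_pow_smul [CharZero K] [IsDomain A]
    [UniqueFactorizationMonoid A] (d : Derivation K A A) (T : M →+ M) (l : M →ₗ[A] A)
    (hT : ∀ a m, T (a • m) = d a • m + a • T m) {a : A} {m : M} (hm : l m ≠ 0)
    (h : ∀ k, ∃ N, T^[N] (a ^ k • m) = 0) : ∃ N, d^[N] a = 0 := by
  have hq : ∀ k, ∃ q : Polynomial A, expSeries K T l (a ^ k • m) = q := fun k =>
    (h k).elim fun N hN => expSeries_eq_polynomial l hN
  obtain ⟨g, hg⟩ := hq 0
  rw [pow_zero, one_smul] at hg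
  have hg0 : g ≠ 0 := by
    rintro rfl
    have := congrArg (PowerSeries.coeff 0) hg
    simp [expSeries, hm] at this
  -- The common denominator of all powers of exp(td)(a) is g, the exponential of m, nonzero because
  -- its constant term is `l m`.
  obtain ⟨q, hb⟩ := exists_polynomial_of_pow_mul
    (b := expSeries K (d : A →+ A) LinearMap.id a) hg0 fun k => by
      rw [← hg, ← expSeries_pow_smul d T l hT]
      exact hq k
  refine ⟨q.natDegree + 1, ?_⟩
  have := congrArg (PowerSeries.coeff (q.natDegree + 1)) hb
  rw [Polynomial.coeff_coe, Polynomial.coeff_eq_zero_of_natDegree_lt (Nat.lt_succ_self _),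
    expSeries, PowerSeries.coeff_mk, smul_eq_zero] at this
  exact this.resolve_left (inv_ne_zero (Nat.cast_ne_zero.2 (Nat.factorial_ne_zero _)))

end Exponential

theorem isLocNilp_of_X {d : D K n} (h : ∀ i, ∃ N, d^[N] (X i) = 0) : IsLocNilp d := by
  intro p
  induction p using MvPolynomial.induction_on with
  | C c => exact ⟨1, derivation_C d c⟩
  | add p q hp hq =>
    obtain ⟨M, hM⟩ := hp
    obtain ⟨N, hN⟩ := hq
    refine ⟨M + N, ?_⟩
    rw [iterate_map_add, iterate_eq_zero_of_le _ (Nat.le_add_right M N) hM,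
      iterate_eq_zero_of_le _ (Nat.le_add_left N M) hN, add_zero]
  | mul_X p i hp =>
    obtain ⟨M, hM⟩ := hp
    obtain ⟨N, hN⟩ := h i
    refine ⟨M + N, ?_⟩
    have := iterate_smul_leibniz d (d : P K n →+ P K n)
      (fun a m => by
        change d (a • m) = _
        rw [smul_eq_mul, d.leibniz, add_comm, smul_eq_mul, smul_eq_mul, smul_eq_mul, smul_eq_mul,
          mul_comm m]
        rfl) (M + N) p (X i)
    rw [smul_eq_mul] at this
    refine this.trans (Finset.sum_eq_zero fun ij hij => ?_)
    have hij := Finset.HasAntidiagonal.mem_antidiagonal.1 hij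
    rcases le_or_gt M ij.1 with h1 | h1
    · rw [iterate_eq_zero_of_le d h1 hM, zero_smul, smul_zero]
    · have h2 : d^[ij.2] (X i) = 0 := iterate_eq_zero_of_le d (by omega) hN
      have h3 : (d : P K n →+ P K n)^[ij.2] (X i) = 0 := h2
      rw [h3, smul_zero, smul_zero]

theorem smul_pderiv_mem {j : Fin n} {p : P K n} (h : pderiv j p = 0) :
    p • (pderiv j : D K n) ∈ divZero K n := by
  rw [mem_divZero, divergence, Finset.sum_eq_single j]
  · simp [h]
  · intro k _ hk
    simp [pderiv_X_of_ne hk]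
  · simp

/-- An element of the Lie algebra of divergence-free vector fields with locally nilpotent adjoint
action is a locally nilpotent derivation. -/
theorem isLocNilp_of_ad [CharZero K] [Nontrivial (Fin n)] {d : D K n}
    (h : ∀ e ∈ divZero K n, ∃ N, (fun x => ⁅d, x⁆)^[N] e = 0) : IsLocNilp d := by
  refine isLocNilp_of_X fun i => ?_
  obtain ⟨j, hj⟩ := exists_ne i
  let l : D K n →ₗ[P K n] P K n :=
    { toFun e := e (X j)
      map_add' _ _ := rfl
      map_smul' _ _ := rfl }
  let T : D K n →+ D K n :=
    { toFun e := ⁅d, e⁆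
      map_zero' := lie_zero d
      map_add' := lie_add d }
  -- The test fields are x_i^k ∂_j, which are divergence-free because j ≠ i; this is where two
  -- variables are needed.
  refine exists_iterate_eq_zero_of_pow_smul d T l (m := pderiv j) (fun a m => ?_) ?_ fun k =>
    h _ (smul_pderiv_mem ?_)
  · refine Derivation.ext fun p => ?_
    simp only [T, AddMonoidHom.coe_mk, ZeroHom.coe_mk, Derivation.commutator_apply,
      Derivation.add_apply, Derivation.smul_apply, smul_eq_mul, Derivation.leibniz]
    ring
  · simp [l]
  · rw [pderiv_pow, pderiv_X_of_ne hj.symm, mul_zero]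

/-! ### Straightening commuting locally nilpotent derivations. -/

/-- For commuting locally nilpotent derivations, a nonempty set of polynomials without zero has
an element that each of the derivations takes out of the set. -/
theorem exists_forall_apply_notMem {e : Fin n → D K n} (hnil : ∀ i, IsLocNilp (e i))
    (hc : ∀ i j p, e i (e j p) = e j (e i p)) {S : Set (P K n)} (h0 : 0 ∉ S) (hS : S.Nonempty) :
    ∃ g ∈ S, ∀ i, e i g ∉ S := by
  classical
  let N : Fin n → P K n → ℕ := fun i p => Nat.find (hnil i p)
  have hN : ∀ i p, (e i)^[N i p] p = 0 := fun i p => Nat.find_spec (hnil i p)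
  -- Minimise the sum of the nilpotency orders: applying `e i` to g lowers the i-th order and, by
  -- commutation, raises no other.
  obtain ⟨g, hg, hmin⟩ := (measure fun p => ∑ i, N i p).wf.has_min S hS
  refine ⟨g, hg, fun i hi => hmin _ hi ?_⟩
  change ∑ j, N j (e i g) < ∑ j, N j g
  refine Finset.sum_lt_sum (fun j _ => Nat.find_min' _ ?_) ⟨i, Finset.mem_univ i, ?_⟩
  · have hcomm : Function.Commute (e j) (e i) := hc j i
    rw [hcomm.iterate_left (N j g) g, hN, map_zero]
  · have hpos : N i g ≠ 0 := fun h => by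
      have := hN i g
      rw [h] at this
      exact h0 (this ▸ hg)
    obtain ⟨k, hk⟩ := Nat.exists_eq_succ_of_ne_zero hpos
    rw [hk]
    refine Nat.lt_succ_of_le (Nat.find_min' _ ?_)
    have := hN i g
    rwa [hk, Function.iterate_succ_apply] at this

section Dual

variable {e : Fin n → D K n} {y : Fin n → P K n}

theorem apply_aeval_of_dual (h : ∀ i j, e i (y j) = if i = j then 1 else 0) (i : Fin n)
    (f : P K n) : e i (aeval y f) = aeval y (pderiv i f) := by
  induction f using MvPolynomial.induction_on with
  | C c => simp [algebraMap_eq]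
  | add p q hp hq => simp only [map_add, hp, hq]
  | mul_X p j hp =>
    simp only [map_mul, map_add, aeval_X, Derivation.leibniz, hp, h, smul_eq_mul, pderiv_X,
      Pi.single_apply]
    by_cases hij : i = j
    · simp [hij]
    · simp [hij, Ne.symm hij]

/-- Partial derivatives of a relation among the y_j are again relations. A minimal nonzero relation
thus has zero partial derivatives, so it is a nonzero constant, which is absurd. -/
theorem aeval_injective_of_dual [CharZero K] (h : ∀ i j, e i (y j) = if i = j then 1 else 0) :
    Function.Injective (aeval y : P K n →ₐ[K] P K n) := by
  rw [injective_iff_map_eq_zero]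
  by_contra! hne
  obtain ⟨g, ⟨hg0, hg⟩, hmin⟩ := exists_forall_apply_notMem
    (e := fun i => (pderiv i : D K n)) isLocNilp_pderiv pderiv_comm
    (S := {f | aeval y f = 0 ∧ f ≠ 0}) (fun h => h.2 rfl) hne
  have hC := eq_C_of_pderiv_eq_zero fun i => by
    by_contra hi
    refine hmin i ⟨?_, hi⟩
    rw [← apply_aeval_of_dual h, hg0, map_zero]
  rw [hC, aeval_C, algebraMap_eq, C_eq_zero] at hg0
  exact hg (by rw [hC, hg0, C_0])

/-- Integration one direction at a time: `S` lists the derivations that may not yet kill p. -/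
theorem aeval_surjective_of_dual [CharZero K]
    (h : ∀ i j, e i (y j) = if i = j then 1 else 0) (hnil : ∀ i, IsLocNilp (e i))
    (hc : ∀ i j p, e i (e j p) = e j (e i p))
    (hker : ∀ p, (∀ i, e i p = 0) → ∃ c, p = C c) :
    Function.Surjective (aeval y : P K n →ₐ[K] P K n) := by
  have key : ∀ (S : Finset (Fin n)) (p : P K n), (∀ i ∉ S, e i p = 0) →
      ∃ f : P K n, aeval y f = p := by
    intro S
    induction S using Finset.induction_on with
    | empty =>
      intro p hp
      obtain ⟨c, rfl⟩ := hker p fun i => hp i (Finset.notMem_empty i)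
      exact ⟨C c, by rw [aeval_C, algebraMap_eq]⟩
    | insert s S _ ih =>
      intro p hp
      obtain ⟨N, hN⟩ := hnil s p
      induction N generalizing p with
      | zero => exact ⟨0, by rw [map_zero]; exact hN.symm⟩
      | succ N ihN =>
        obtain ⟨f, hf⟩ := ihN (e s p) (fun i hi => by rw [hc, hp i hi, map_zero]) hN
        -- As f represents `e s p`, subtracting its integral in direction s leaves something killed
        -- by `e s`; the other vanishing conditions survive because injectivity gives ∂_i f = 0.
        obtain ⟨q, hq⟩ := ih (p - aeval y (antideriv s f)) fun i hi => by
          rw [map_sub, apply_aeval_of_dual h]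
          rcases eq_or_ne s i with rfl | hsi
          · rw [pderiv_antideriv_self, hf, sub_self]
          · have hpi : e i p = 0 := hp i (by simp [hi, hsi.symm])
            have hfi : pderiv i f = 0 := aeval_injective_of_dual h (by
              rw [← apply_aeval_of_dual h, hf, hc, hpi, map_zero, map_zero])
            rw [hpi, pderiv_antideriv_of_ne hsi, hfi, map_zero, map_zero, sub_zero]
        exact ⟨q + antideriv s f, by rw [map_add, hq, sub_add_cancel]⟩
  exact fun p => key Finset.univ p fun i hi => absurd (Finset.mem_univ i) hi

/-- Commuting locally nilpotent derivations with trivial common kernel and dual coordinates are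
simultaneously conjugate to the partial derivatives. -/
theorem exists_conjD_pderiv_eq [CharZero K]
    (h : ∀ i j, e i (y j) = if i = j then 1 else 0) (hnil : ∀ i, IsLocNilp (e i))
    (hc : ∀ i j p, e i (e j p) = e j (e i p))
    (hker : ∀ p, (∀ i, e i p = 0) → ∃ c, p = C c) :
    ∃ σ : G K n, (∀ i, σ (X i) = y i) ∧ ∀ i, conjD σ (pderiv i) = e i := by
  let σ : G K n := AlgEquiv.ofBijective (aeval y : P K n →ₐ[K] P K n)
    ⟨aeval_injective_of_dual h, aeval_surjective_of_dual h hnil hc hker⟩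
  have hσ : ∀ f, σ f = aeval y f := fun _ => rfl
  refine ⟨σ, fun i => by rw [hσ, aeval_X], fun i => Derivation.ext fun p => ?_⟩
  obtain ⟨q, rfl⟩ := σ.surjective p
  rw [conjD_apply_map, hσ, hσ, apply_aeval_of_dual h]

end Dual

/-- Dual coordinates for commuting derivations, obtained from one polynomial with constant
derivatives and fields that act on the derivations as elementary matrices. -/
theorem exists_dual [Nontrivial (Fin n)] {e : Fin n → D K n} {u : Fin n → Fin n → D K n}
    (hu : ∀ i j, i ≠ j → ∀ k p, e k (u i j p) = u i j (e k p) + if k = i then e j p else 0)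
    {g : P K n} {c : Fin n → K} (hg : ∀ i, e i g = C (c i)) {j : Fin n} (hj : c j ≠ 0) :
    ∃ y : Fin n → P K n, ∀ k i, e k (y i) = if k = i then 1 else 0 := by
  obtain ⟨i₀, hi₀⟩ := exists_ne j
  have h1 : ∀ i, i ≠ j → ∀ k, e k ((c j)⁻¹ • u i j g) = if k = i then 1 else 0 := by
    intro i hi k
    rw [Derivation.map_smul, hu i j hi, hg, derivation_C, zero_add, hg]
    split_ifs
    · rw [smul_eq_C_mul, ← C_mul, inv_mul_cancel₀ hj, C_1]
    · rw [smul_zero]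
  -- The field `u j j` is unavailable, so the coordinate dual to `e j` comes from the one for i₀,
  -- moved by `u j i₀`.
  have h2 : ∀ k, e k (u j i₀ ((c j)⁻¹ • u i₀ j g)) = if k = j then 1 else 0 := by
    intro k
    rw [hu j i₀ hi₀.symm, h1 i₀ hi₀, h1 i₀ hi₀, if_pos rfl]
    split_ifs <;> simp
  refine ⟨fun i => if i = j then u j i₀ ((c j)⁻¹ • u i₀ j g) else (c j)⁻¹ • u i j g,
    fun k i => ?_⟩
  dsimp only
  split_ifs with hi hki hki
  · rw [h2, if_pos (hki.trans hi)]
  · rw [h2, if_neg fun h => hki (h.trans hi.symm)]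
  · rw [h1 i hi, if_pos hki]
  · rw [h1 i hi, if_neg hki]

/-- If a polynomial has multiples `aᵏ d`, with `d ≠ 0`, in a finite-dimensional space of
derivations for all `k`, then it is constant. -/
theorem eq_C_of_pow_smul_mem_span {a : P K n} {d : D K n} (hd : d ≠ 0) {e : Fin n → D K n}
    (h : ∀ k : ℕ, ∃ c : Fin n → K, a ^ k • d = ∑ i, c i • e i) : ∃ c, a = C c := by
  obtain ⟨l, hl⟩ : ∃ l, d (X l) ≠ 0 := by
    by_contra! hc
    exact hd (derivation_ext hc)
  by_contra! hne
  have ha : 1 ≤ a.totalDegree := by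
    by_contra! h0
    exact hne _ (totalDegree_eq_zero_iff_eq_C.1 (Nat.lt_one_iff.1 h0))
  have ha0 : a ≠ 0 := fun h0 => hne 0 (by rw [h0, C_0])
  -- N bounds the degree of the l-th coefficient on the whole span, while a^(N+1) d exceeds it.
  set N := Finset.univ.sup fun i => (e i (X l)).totalDegree with hN
  obtain ⟨c, hc⟩ := h (N + 1)
  have hc' : a ^ (N + 1) * d (X l) = ∑ i, c i • e i (X l) := by
    have := congrArg (fun x : D K n => x (X l)) hc
    rw [← Derivation.coeFnAddMonoidHom_apply (∑ i, c i • e i), map_sum, Finset.sum_apply] at this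
    exact this
  have hle : (a ^ (N + 1) * d (X l)).totalDegree ≤ N := by
    rw [hc']
    refine totalDegree_finsetSum_le fun i _ => (totalDegree_smul_le _ _).trans ?_
    exact Finset.le_sup (f := fun i => (e i (X l)).totalDegree) (Finset.mem_univ i)
  have hpow : ∀ k : ℕ, k ≤ (a ^ k).totalDegree := by
    intro k
    induction k with
    | zero => exact Nat.zero_le _
    | succ k ih =>
      rw [pow_succ, totalDegree_mul_of_isDomain (pow_ne_zero _ ha0) ha0]
      exact add_le_add ih ha
  rw [totalDegree_mul_of_isDomain (pow_ne_zero _ ha0) hl] at hle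
  have := hpow (N + 1)
  omega

/-! ### Elementary divergence-free fields and their brackets. -/

/-- The field `p ∂_j`, when `p` does not depend on `x_j`. -/
noncomputable def vf (j : Fin n) (p : P K n) : divZero K n :=
  open Classical in if h : pderiv j p = 0 then ⟨p • pderiv j, smul_pderiv_mem h⟩ else 0

theorem coe_vf {j : Fin n} {p : P K n} (h : pderiv j p = 0) :
    (vf j p : D K n) = p • (pderiv j : D K n) := by
  rw [vf, dif_pos h]

theorem coe_vf_one (j : Fin n) : (vf j (1 : P K n) : D K n) = (pderiv j : D K n) := by
  rw [coe_vf pderiv_one, one_smul]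

theorem coe_vf_X {i j : Fin n} (h : i ≠ j) : (vf j (X i : P K n) : D K n) = (X i : P K n) • (pderiv j : D K n) :=
  coe_vf (pderiv_X_of_ne h)

/-- The linear diagonal field `∑ wᵢ xᵢ ∂ᵢ`. -/
noncomputable def diagD (w : Fin n → K) : D K n := mkDerivation K fun i => w i • X i

theorem diagD_X (w : Fin n → K) (i : Fin n) : diagD w (X i) = w i • X i := mkDerivation_X ..

theorem diagD_mem {w : Fin n → K} (hw : ∑ i, w i = 0) : diagD w ∈ divZero K n := by
  rw [mem_divZero, divergence]
  simp only [diagD_X, Derivation.map_smul, pderiv_X_self]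
  rw [← Finset.sum_smul, hw, zero_smul]

/-- The linear diagonal field of trace zero, as a divergence-free field. -/
noncomputable def diag (w : Fin n → K) (hw : ∑ i, w i = 0) : divZero K n := ⟨diagD w, diagD_mem hw⟩

theorem pderiv_lie_X (k i : Fin n) (d : D K n) :
    ⁅(pderiv k : D K n), d⁆ (X i) = pderiv k (d (X i)) := by
  rw [Derivation.commutator_apply, pderiv_X, Pi.single_apply]
  split_ifs <;> simp

theorem lie_vf_one_shear {i j : Fin n} (hij : i ≠ j) (k : Fin n) :
    ⁅(vf k 1 : divZero K n), vf j (X i)⁆ = if k = i then vf j (1 : P K n) else 0 := by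
  refine Subtype.ext (derivation_ext fun l => ?_)
  rw [LieSubalgebra.coe_bracket, coe_vf_one, coe_vf_X hij, pderiv_lie_X]
  split_ifs with hk
  · rw [coe_vf_one, hk, Derivation.smul_apply, pderiv_X, Pi.single_apply]
    split_ifs <;> simp
  · rw [Derivation.smul_apply, pderiv_X, Pi.single_apply]
    split_ifs <;> simp [pderiv_X_of_ne (Ne.symm hk)]

theorem lie_vf_one_diag {w : Fin n → K} (hw : ∑ i, w i = 0) (k : Fin n) :
    ⁅(vf k 1 : divZero K n), diag w hw⁆ = w k • vf k 1 := by
  refine Subtype.ext (derivation_ext fun l => ?_)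
  rw [LieSubalgebra.coe_bracket, coe_vf_one, diag, pderiv_lie_X, SetLike.val_smul,
    coe_vf_one, diagD_X, Derivation.smul_apply, Derivation.map_smul, pderiv_X, Pi.single_apply]
  split_ifs with h
  · rw [h]
  · simp

theorem lie_vf_one_vf_one (i j : Fin n) : ⁅(vf i (1 : P K n)), vf j (1 : P K n)⁆ = 0 := by
  refine Subtype.ext (derivation_ext fun l => ?_)
  rw [LieSubalgebra.coe_bracket, coe_vf_one, coe_vf_one, pderiv_lie_X, pderiv_X, Pi.single_apply]
  split_ifs <;> simp

theorem coe_sum_smul_vf_one_X (c : Fin n → K) (i : Fin n) :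
    ((∑ k, c k • vf k 1 : divZero K n) : D K n) (X i) = C (c i) := by
  have h : ((∑ k, c k • vf k 1 : divZero K n) : D K n)
      = ∑ k, c k • (pderiv k : D K n) := by
    simp [coe_vf_one]
  rw [h, ← Derivation.coeFnAddMonoidHom_apply, map_sum, Finset.sum_apply]
  simp [pderiv_X, Pi.single_apply, smul_eq_C_mul]

/-- A field that commutes with the partial derivatives is constant. -/
theorem exists_eq_sum_smul_vf_one [CharZero K] {x : divZero K n}
    (h : ∀ k, ⁅(vf k 1 : divZero K n), x⁆ = 0) : ∃ c : Fin n → K, x = ∑ k, c k • vf k 1 := by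
  have hC : ∀ i, (x : D K n) (X i) = C (coeff 0 ((x : D K n) (X i))) := fun i =>
    eq_C_of_pderiv_eq_zero fun k => by
      rw [← pderiv_lie_X, ← coe_vf_one, ← LieSubalgebra.coe_bracket, h]
      rfl
  refine ⟨fun i => coeff 0 ((x : D K n) (X i)), Subtype.ext (derivation_ext fun i => ?_)⟩
  rw [coe_sum_smul_vf_one_X]
  exact hC i

theorem exists_iterate_lie_pderiv_eq_zero (i : Fin n) (d : D K n) :
    ∃ N, (fun x => ⁅(pderiv i : D K n), x⁆)^[N] d = 0 := by
  have h : ∀ N k, ((fun x => ⁅(pderiv i : D K n), x⁆)^[N] d) (X k)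
      = (pderiv i)^[N] (d (X k)) := by
    intro N k
    induction N with
    | zero => rfl
    | succ N ih => rw [Function.iterate_succ_apply', pderiv_lie_X, ih, Function.iterate_succ_apply']
  choose N hN using fun k => isLocNilp_pderiv i (d (X k))
  refine ⟨∑ k, N k, derivation_ext fun k => ?_⟩
  rw [h, iterate_eq_zero_of_le _ (Finset.single_le_sum (fun _ _ => Nat.zero_le _)
    (Finset.mem_univ k)) (hN k)]
  rfl

/-! ### Images of the partial derivatives under an automorphism. -/

section Automorphism

variable (φ : LieAut K (divZero K n))

theorem coe_map_lie (x y : divZero K n) :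
    (φ ⁅x, y⁆ : D K n) = ⁅(φ x : D K n), (φ y : D K n)⁆ := by
  rw [LieEquiv.map_lie, LieSubalgebra.coe_bracket]

theorem isLocNilp_map_vf_one [CharZero K] [Nontrivial (Fin n)] (i : Fin n) :
    IsLocNilp (φ (vf i 1) : D K n) := by
  refine isLocNilp_of_ad fun e he => ?_
  obtain ⟨N, hN⟩ := exists_iterate_lie_pderiv_eq_zero i (φ.symm ⟨e, he⟩ : D K n)
  have h1 : ∀ N, (((fun x => ⁅(vf i 1 : divZero K n), x⁆)^[N] (φ.symm ⟨e, he⟩) : divZero K n) : D K n)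
      = (fun x => ⁅(pderiv i : D K n), x⁆)^[N] (φ.symm ⟨e, he⟩ : D K n) := by
    intro N
    induction N with
    | zero => rfl
    | succ N ih =>
      rw [Function.iterate_succ_apply', Function.iterate_succ_apply', LieSubalgebra.coe_bracket,
        coe_vf_one, ih]
  have h2 : ∀ N, (φ ((fun x => ⁅(vf i 1 : divZero K n), x⁆)^[N] (φ.symm ⟨e, he⟩)) : D K n)
      = (fun x => ⁅(φ (vf i 1) : D K n), x⁆)^[N] e := by
    intro N
    induction N with
    | zero => exact congrArg Subtype.val (φ.apply_symm_apply ⟨e, he⟩)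
    | succ N ih =>
      rw [Function.iterate_succ_apply', Function.iterate_succ_apply', coe_map_lie, ih]
  refine ⟨N, ?_⟩
  have h3 : (fun x => ⁅(vf i 1 : divZero K n), x⁆)^[N] (φ.symm ⟨e, he⟩) = 0 :=
    Subtype.ext ((h1 N).trans hN)
  rw [← h2, h3, map_zero]
  rfl

theorem map_vf_one_comm (i j : Fin n) (p : P K n) :
    (φ (vf i 1) : D K n) ((φ (vf j 1) : D K n) p)
      = (φ (vf j 1) : D K n) ((φ (vf i 1) : D K n) p) := by
  have h := coe_map_lie φ (vf i 1) (vf j 1)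
  rw [lie_vf_one_vf_one, map_zero] at h
  have h2 := congrArg (fun d : D K n => d p) h
  exact sub_eq_zero.1 h2.symm

theorem vf_one_ne_zero (i : Fin n) : (vf i 1 : divZero K n) ≠ 0 := fun h => by
  have := congrArg (fun x : divZero K n => (x : D K n) (X i)) h
  simp [coe_vf_one] at this

theorem exists_eq_C_of_map_vf_one [CharZero K] [Nontrivial (Fin n)] {a : P K n}
    (ha : ∀ i, (φ (vf i 1) : D K n) a = 0) : ∃ c, a = C c := by
  obtain ⟨i₀⟩ : Nonempty (Fin n) := inferInstance
  refine eq_C_of_pow_smul_mem_span (d := (φ (vf i₀ 1) : D K n))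
    (e := fun i => (φ (vf i 1) : D K n)) (fun h => ?_) fun k => ?_
  · refine vf_one_ne_zero i₀ (φ.injective (Subtype.ext ?_))
    change (φ (vf i₀ 1) : D K n) = (φ 0 : D K n)
    rw [h, map_zero]
    rfl
  have hak : ∀ i, (φ (vf i 1) : D K n) (a ^ k) = 0 := fun i => by
    rw [Derivation.leibniz_pow, ha, smul_zero, smul_zero]
  have hmem : a ^ k • (φ (vf i₀ 1) : D K n) ∈ divZero K n := by
    have h0 : divergence (φ (vf i₀ 1) : D K n) = 0 := (φ (vf i₀ 1)).2
    rw [divergence] at h0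
    rw [mem_divZero, divergence]
    simp only [Derivation.smul_apply, smul_eq_mul, pderiv_mul]
    rw [Finset.sum_add_distrib, ← Finset.mul_sum, h0, mul_zero, add_zero, ← hak i₀,
      apply_eq_sum (φ (vf i₀ 1) : D K n) (a ^ k)]
    exact Finset.sum_congr rfl fun i _ => mul_comm _ _
  obtain ⟨c, hc⟩ := exists_eq_sum_smul_vf_one (x := φ.symm ⟨_, hmem⟩) fun i => by
    apply φ.injective
    refine Subtype.ext (Derivation.ext fun p => ?_)
    change (φ _ : D K n) p = (φ 0 : D K n) p
    rw [coe_map_lie, φ.apply_symm_apply, map_zero, Derivation.commutator_apply]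
    simp only [Derivation.smul_apply, smul_eq_mul, Derivation.leibniz, hak]
    rw [map_vf_one_comm φ i i₀]
    simp
  refine ⟨c, ?_⟩
  have h1 := congrArg (fun x => (φ x : D K n)) hc
  simpa using h1

/-- Up to conjugation, an automorphism fixes the partial derivatives and a diagonal field. -/
theorem exists_conj_eq [CharZero K] [Nontrivial (Fin n)] {w : Fin n → K} (hw : ∑ i, w i = 0)
    (hw0 : ∀ i, w i ≠ 0) :
    ∃ σ : G K n, (∀ i, conj K n σ (vf i 1) = φ (vf i 1)) ∧
      conj K n σ (diag w hw) = φ (diag w hw) := by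
  set e : Fin n → D K n := fun i => (φ (vf i 1) : D K n) with he
  have hnil : ∀ i, IsLocNilp (e i) := isLocNilp_map_vf_one φ
  have hc : ∀ i j p, e i (e j p) = e j (e i p) := map_vf_one_comm φ
  have hker : ∀ p, (∀ i, e i p = 0) → ∃ c, p = C c := fun p => exists_eq_C_of_map_vf_one φ
  obtain ⟨i₀⟩ : Nonempty (Fin n) := inferInstance
  -- A minimal nonconstant g has all `e i g` constant; they are not all zero, since the common
  -- kernel is K.
  obtain ⟨g, hg, hmin⟩ := exists_forall_apply_notMem hnil hc (S := {p | ¬ ∃ c, p = C c})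
    (fun h => h ⟨0, C_0.symm⟩) ⟨X i₀, fun ⟨c, h⟩ => by
      have := congrArg (pderiv i₀) h
      simp at this⟩
  have hmin' : ∀ i, ∃ c, e i g = C c := fun i => not_not.1 (hmin i)
  choose c hcg using hmin'
  obtain ⟨j, hj⟩ : ∃ j, c j ≠ 0 := by
    by_contra! h
    exact hg (hker g fun i => by rw [hcg, h, C_0])
  obtain ⟨y, hy⟩ := exists_dual (e := e) (u := fun i j => (φ (vf j (X i)) : D K n))
    (fun i j hij k p => by
      have h1 := coe_map_lie φ (vf k 1) (vf j (X i))
      rw [lie_vf_one_shear hij] at h1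
      have h2 := congrArg (fun d : D K n => d p) h1
      rw [Derivation.commutator_apply] at h2
      rw [← sub_eq_iff_eq_add', ← h2]
      split_ifs
      · rfl
      · rw [map_zero]
        rfl) hcg hj
  set v : D K n := (φ (diag w hw) : D K n) with hv
  have hev : ∀ k p, e k (v p) = v (e k p) + w k • e k p := by
    intro k p
    have h1 := coe_map_lie φ (vf k 1) (diag w hw)
    rw [lie_vf_one_diag] at h1
    have h2 := congrArg (fun d : D K n => d p) h1
    rw [Derivation.commutator_apply, map_smul] at h2
    rw [← sub_eq_iff_eq_add']
    exact h2.symm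
  -- By [e_k, v] = w_k e_k the difference is killed by every e_k. The shift by s_i / w_i below then
  -- makes each coordinate an eigenvector of v.
  have hvy : ∀ i, ∃ s, v (y i) - w i • y i = C s := fun i => hker _ fun k => by
    rw [map_sub, hev, Derivation.map_smul, hy]
    split_ifs with h
    · simp [h]
    · simp
  choose s hs using hvy
  obtain ⟨σ, hσy, hσ⟩ := exists_conjD_pderiv_eq (e := e)
    (y := fun i => y i + C ((w i)⁻¹ * s i)) (fun i j => by
      rw [map_add, derivation_C, add_zero, hy]) hnil hc hker
  refine ⟨σ, fun i => Subtype.ext ?_, Subtype.ext ?_⟩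
  · rw [coe_conj, coe_vf_one]
    exact hσ i
  · rw [coe_conj, ← hv, ← conjD_conjD_inv σ v]
    congr 1
    refine derivation_ext fun i => ?_
    have hσi : ∀ q, (σ⁻¹ : G K n) (σ q) = q := σ.symm_apply_apply
    rw [conjD_apply, inv_inv, hσy, map_add, derivation_C, add_zero, sub_eq_iff_eq_add.1 (hs i)]
    have h1 : C (s i) + w i • y i = w i • (y i + C ((w i)⁻¹ * s i)) := by
      rw [smul_add, smul_eq_C_mul (C _), ← C_mul, mul_inv_cancel_left₀ (hw0 i), add_comm]
    rw [h1, ← hσy, map_smul, hσi, diag, diagD_X]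

end Automorphism

/-! ### Rigidity of automorphisms fixing the partial derivatives and a diagonal field. -/

/-- Weights of trace zero in general position. -/
theorem exists_weights [CharZero K] [Nontrivial (Fin n)] :
    ∃ w : Fin n → K, ∑ i, w i = 0 ∧ ∀ i j k, w i - w j + w k ≠ 0 := by
  obtain ⟨i₀⟩ : Nonempty (Fin n) := inferInstance
  have hn : 2 ≤ n := Fin.nontrivial_iff_two_le.1 inferInstance
  -- The weights are 1, except 1 - n at i₀, so w_i - w_j + w_k is one of 1, 1 - n, 1 + n, 1 - 2n.
  refine ⟨fun i => 1 - if i = i₀ then (n : K) else 0, by simp, fun i j k => ?_⟩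
  have h1 : (1 : K) - n ≠ 0 := by
    rw [sub_ne_zero]
    exact_mod_cast (by omega : 1 ≠ n)
  have h2 : (1 : K) + n ≠ 0 := by exact_mod_cast (by omega : 1 + n ≠ 0)
  have h3 : (1 : K) - 2 * n ≠ 0 := by
    rw [sub_ne_zero]
    exact_mod_cast (by omega : 1 ≠ 2 * n)
  dsimp only
  intro h
  split_ifs at h <;> first
    | exact one_ne_zero (α := K) (by linear_combination h)
    | exact h1 (by linear_combination h)
    | exact h2 (by linear_combination h)
    | exact h3 (by linear_combination h)

section Fixed

variable (φ : LieAut K (divZero K n))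

/-- The vector fields fixed by an automorphism. -/
noncomputable def fixedD : LieSubalgebra K (D K n) where
  carrier := {d | ∃ h : d ∈ divZero K n, φ ⟨d, h⟩ = ⟨d, h⟩}
  zero_mem' := ⟨zero_mem _, map_zero φ⟩
  add_mem' := by
    rintro a b ⟨ha, ha'⟩ ⟨hb, hb'⟩
    refine ⟨add_mem ha hb, ?_⟩
    have := map_add φ ⟨a, ha⟩ ⟨b, hb⟩
    rw [ha', hb'] at this
    exact this
  smul_mem' := by
    rintro c a ⟨ha, ha'⟩
    refine ⟨(divZero K n).smul_mem c ha, ?_⟩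
    have := map_smul φ c ⟨a, ha⟩
    rw [ha'] at this
    exact this
  lie_mem' := by
    rintro a b ⟨ha, ha'⟩ ⟨hb, hb'⟩
    refine ⟨(divZero K n).lie_mem ha hb, ?_⟩
    have := φ.map_lie ⟨a, ha⟩ ⟨b, hb⟩
    rw [ha', hb'] at this
    exact this

variable {φ}

theorem coe_mem_fixedD {x : divZero K n} : (x : D K n) ∈ fixedD φ ↔ φ x = x :=
  ⟨fun h => h.2, fun h => ⟨x.2, h⟩⟩

theorem map_lie_of_fixed {x : divZero K n} (hx : φ x = x) (y : divZero K n) :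
    φ ⁅x, y⁆ = ⁅x, φ y⁆ := by
  rw [LieEquiv.map_lie, hx]

/-- The error φ(x) - x commutes with all ∂_k, so it is a constant field. -/
theorem exists_map_eq_add [CharZero K] (hd : ∀ i, φ (vf i 1) = vf i 1) {x : divZero K n}
    (hx : ∀ k, φ ⁅vf k (1 : P K n), x⁆ = ⁅vf k (1 : P K n), x⁆) :
    ∃ c : Fin n → K, φ x = x + ∑ k, c k • vf k (1 : P K n) := by
  obtain ⟨c, hc⟩ := exists_eq_sum_smul_vf_one (x := φ x - x) fun k => by
    rw [lie_sub, ← map_lie_of_fixed (hd k), hx, sub_self]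
  exact ⟨c, by rw [← hc, add_sub_cancel]⟩

theorem lie_diag_shear {w : Fin n → K} (hw : ∑ i, w i = 0) {i j : Fin n} (hij : i ≠ j) :
    ⁅diag w hw, vf j (X i : P K n)⁆ = (w i - w j) • vf j (X i : P K n) := by
  refine Subtype.ext (derivation_ext fun l => ?_)
  rw [LieSubalgebra.coe_bracket, SetLike.val_smul, coe_vf_X hij, Derivation.commutator_apply, diag,
    diagD_X]
  simp only [Derivation.smul_apply, Derivation.map_smul, pderiv_X, Pi.single_apply, smul_eq_mul]
  split_ifs with hl
  · subst hl
    rw [mul_one, diagD_X, sub_smul]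
  · simp

/-- The diagonal field acts on x_i ∂_j with weight w_i - w_j and on ∂_k with weight -w_k. These
differ by genericity, so the constant error vanishes. -/
theorem map_shear_eq [CharZero K] (hd : ∀ i, φ (vf i 1) = vf i 1) {w : Fin n → K}
    {hw : ∑ i, w i = 0} (hgen : ∀ i j k, w i - w j + w k ≠ 0) (hH : φ (diag w hw) = diag w hw)
    {i j : Fin n} (hij : i ≠ j) : φ (vf j (X i)) = vf j (X i) := by
  obtain ⟨c, hc⟩ := exists_map_eq_add hd (x := vf j (X i)) fun k => by
    rw [lie_vf_one_shear hij]
    split_ifs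
    · exact hd j
    · exact map_zero φ
  have h1 := map_lie_of_fixed hH (vf j (X i))
  rw [lie_diag_shear hw hij, map_smul, hc, lie_add, lie_diag_shear hw hij, smul_add,
    add_right_inj] at h1
  have hc0 : c = 0 := by
    funext k
    have h2 := congrArg (fun x : divZero K n => (x : D K n) (X k)) h1
    simp only [LieSubalgebra.coe_bracket, SetLike.val_smul, Derivation.commutator_apply,
      Derivation.smul_apply, coe_sum_smul_vf_one_X, derivation_C] at h2
    rw [diag, diagD_X, Derivation.map_smul, coe_sum_smul_vf_one_X, smul_eq_C_mul, smul_eq_C_mul,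
      ← C_mul, ← C_mul, zero_sub, ← C_neg] at h2
    have h3 := C_injective _ _ h2
    refine (mul_eq_zero.1 ?_).resolve_left (hgen i j k)
    linear_combination h3
  rw [hc, hc0]
  simp

theorem lie_vf_one_monomial {j : Fin n} {m : Fin n →₀ ℕ} (hm : m j = 0) (k : Fin n) :
    ⁅vf k (1 : P K n), vf j (monomial m (1 : K))⁆
      = (m k : K) • vf j (monomial (m - Finsupp.single k 1) (1 : K)) := by
  have h1 : pderiv j (monomial m (1 : K)) = 0 := by simp [pderiv_monomial, hm]
  have h2 : pderiv j (monomial (m - Finsupp.single k 1) (1 : K)) = 0 := by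
    simp [pderiv_monomial, hm]
  refine Subtype.ext (derivation_ext fun l => ?_)
  rw [LieSubalgebra.coe_bracket, SetLike.val_smul, coe_vf_one, coe_vf h1, pderiv_lie_X, coe_vf h2]
  simp only [Derivation.smul_apply, pderiv_X, Pi.single_apply, smul_eq_mul]
  split_ifs
  · rw [mul_one, mul_one, pderiv_monomial, smul_monomial, smul_eq_mul, mul_comm]
  · simp

theorem coe_lie_shear_shear {i j : Fin n} (hij : i ≠ j) :
    ((⁅vf j (X i : P K n), vf i (X j : P K n)⁆ : divZero K n) : D K n)
      = (X i : P K n) • (pderiv i : D K n) - (X j : P K n) • (pderiv j : D K n) := by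
  refine derivation_ext fun k => ?_
  rw [LieSubalgebra.coe_bracket, coe_vf_X hij, coe_vf_X hij.symm, Derivation.commutator_apply]
  simp only [Derivation.smul_apply, Derivation.sub_apply, pderiv_X, Pi.single_apply, smul_eq_mul]
  split_ifs <;> simp

theorem map_vf_monomial_eq [CharZero K] (hd : ∀ i, φ (vf i 1) = vf i 1)
    (hs : ∀ i j, i ≠ j → φ (vf j (X i)) = vf j (X i)) {j : Fin n} (m : Fin n →₀ ℕ)
    (hm : m j = 0) : φ (vf j (monomial m 1)) = vf j (monomial m 1) := by
  induction hN : m.degree generalizing m with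
  | zero =>
    rw [(Finsupp.degree_eq_zero_iff m).1 hN]
    exact hd j
  | succ N ih =>
    obtain ⟨i, hi⟩ : ∃ i, m i ≠ 0 := by
      by_contra! h
      rw [Finsupp.ext (g := 0) h, map_zero] at hN
      omega
    have hij : i ≠ j := fun h => hi (h ▸ hm)
    have hdeg : ∀ k, m k ≠ 0 → (m - Finsupp.single k 1).degree = N := by
      intro k hk
      have h1 : m - Finsupp.single k 1 + Finsupp.single k 1 = m :=
        tsub_add_cancel_of_le (Finsupp.single_le_iff.2 (Nat.one_le_iff_ne_zero.2 hk))
      have h2 := congrArg Finsupp.degree h1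
      rw [map_add, Finsupp.degree_single, hN] at h2
      omega
    obtain ⟨c, hc⟩ := exists_map_eq_add hd (x := vf j (monomial m 1)) fun k => by
      rw [lie_vf_one_monomial hm, map_smul]
      by_cases hk : m k = 0
      · rw [hk, Nat.cast_zero, zero_smul, zero_smul]
      · rw [ih _ (by simp [hm]) (hdeg k hk)]
    have hp : pderiv j (monomial m (1 : K)) = 0 := by simp [pderiv_monomial, hm]
    -- The fixed field x_k ∂_j commutes with x^m ∂_j, while its bracket with the error is -c_k ∂_j.
    have hck : ∀ k, k ≠ j → c k = 0 := by
      intro k hk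
      have h1 := map_lie_of_fixed (hs k j hk) (vf j (monomial m 1))
      have h2 : ⁅vf j (X k : P K n), vf j (monomial m (1 : K))⁆ = 0 := by
        refine Subtype.ext (derivation_ext fun l => ?_)
        rw [LieSubalgebra.coe_bracket, coe_vf_X hk, coe_vf hp, Derivation.commutator_apply]
        simp only [Derivation.smul_apply, pderiv_X, Pi.single_apply, smul_eq_mul]
        split_ifs <;> simp [hp, pderiv_X_of_ne hk]
      rw [h2, map_zero, hc, lie_add, h2, zero_add] at h1
      have h3 := congrArg (fun x : divZero K n => (x : D K n) (X j)) h1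
      simp only [LieSubalgebra.coe_bracket, Derivation.commutator_apply, coe_sum_smul_vf_one_X,
        derivation_C, coe_vf_X hk, Derivation.smul_apply, pderiv_X_self, smul_eq_mul,
        mul_one, mul_zero, zero_sub] at h3
      exact C_eq_zero.1 (neg_eq_zero.1 h3.symm)
    -- The fixed field x_i ∂_i - x_j ∂_j has weight m_i + 1 on x^m ∂_j but weight 1 on ∂_j, so m_i
    -- c_j = 0.
    have hcj : c j = 0 := by
      set h := ⁅vf j (X i : P K n), vf i (X j : P K n)⁆ with hh
      have hfix : φ h = h := by rw [hh, LieEquiv.map_lie, hs i j hij, hs j i hij.symm]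
      have hlie : ⁅h, vf j (monomial m (1 : K))⁆ = ((m i : K) + 1) • vf j (monomial m (1 : K)) := by
        refine Subtype.ext (derivation_ext fun l => ?_)
        have hm1 := X_mul_pderiv_monomial (i := i) (m := m) (r := (1 : K))
        rw [LieSubalgebra.coe_bracket, SetLike.val_smul, coe_vf hp, hh, coe_lie_shear_shear hij,
          Derivation.commutator_apply]
        simp only [Derivation.smul_apply, Derivation.sub_apply, pderiv_X, Pi.single_apply,
          smul_eq_mul]
        by_cases hl : l = j
        · subst hl
          simp only [if_pos, if_neg hij.symm, mul_one, mul_zero, zero_sub, map_neg, pderiv_X_self,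
            hm1, hp, sub_zero, add_smul, one_smul, mul_neg, sub_neg_eq_add, Nat.cast_smul_eq_nsmul]
        · by_cases hl' : l = i
          · subst hl'
            simp [hij, pderiv_X_of_ne hij]
          · simp [hl, hl']
      have h1 := map_lie_of_fixed hfix (vf j (monomial m 1))
      rw [hlie, map_smul, hc, lie_add, hlie, smul_add, add_right_inj] at h1
      have h3 := congrArg (fun x : divZero K n => (x : D K n) (X j)) h1
      simp only [LieSubalgebra.coe_bracket, Derivation.commutator_apply, coe_sum_smul_vf_one_X,
        derivation_C, SetLike.val_smul, Derivation.smul_apply] at h3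
      rw [hh, coe_lie_shear_shear hij] at h3
      simp only [Derivation.smul_apply, Derivation.sub_apply, pderiv_X_self,
        pderiv_X_of_ne hij.symm, smul_eq_mul, mul_one, mul_zero, zero_sub, map_neg,
        neg_neg, coe_sum_smul_vf_one_X, smul_eq_C_mul, ← C_mul] at h3
      have h4 := C_injective _ _ h3
      refine (mul_eq_zero.1 ?_).resolve_left (Nat.cast_ne_zero (R := K).2 hi)
      linear_combination h4
    have hc0 : c = 0 := by
      funext k
      by_cases hk : k = j
      · rw [hk, hcj]; rfl
      · exact hck k hk
    rw [hc, hc0]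
    simp

end Fixed

section Rigidity

variable {φ : LieAut K (divZero K n)}

theorem smul_pderiv_mem_fixedD [CharZero K]
    (hφ : ∀ (j : Fin n) (m : Fin n →₀ ℕ), m j = 0 → φ (vf j (monomial m 1)) = vf j (monomial m 1))
    {j : Fin n} {g : P K n} (hg : pderiv j g = 0) : g • (pderiv j : D K n) ∈ fixedD φ := by
  rw [g.as_sum, Finset.sum_smul]
  refine sum_mem fun m hm => ?_
  have hmj : m j = 0 := by
    by_contra h0
    have h1 := congrArg (coeff (m - Finsupp.single j 1)) hg
    have h2 : m - Finsupp.single j 1 + Finsupp.single j 1 = m :=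
      tsub_add_cancel_of_le (Finsupp.single_le_iff.2 (Nat.one_le_iff_ne_zero.2 h0))
    rw [coeff_pderiv, h2, coeff_zero] at h1
    exact mem_support_iff.1 hm ((mul_eq_zero.1 h1).resolve_right (Nat.cast_add_one_ne_zero _))
  have h3 : (monomial m (coeff m g) : P K n) • (pderiv j : D K n)
      = coeff m g • (vf j (monomial m (1 : K)) : D K n) := by
    rw [coe_vf (by simp [pderiv_monomial, hmj]), ← smul_assoc, smul_monomial, smul_eq_mul, mul_one]
  rw [h3]
  exact (fixedD φ).smul_mem _ (coe_mem_fixedD.2 (hφ j m hmj))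

/-- For a monomial p = f x_j^a with f free of x_j, take [f ∂_j, g ∂_i] where g integrates x_j^a: its
∂_i-coefficient is f ∂_j g = p, and only ∂_j is disturbed besides. -/
theorem exists_mem_fixedD [CharZero K]
    (hφ : ∀ (j : Fin n) (m : Fin n →₀ ℕ), m j = 0 → φ (vf j (monomial m 1)) = vf j (monomial m 1))
    {i j : Fin n} (hij : i ≠ j) (p : P K n) :
    ∃ d ∈ fixedD φ, d (X i) = p ∧ ∀ k, k ≠ i → k ≠ j → d (X k) = 0 := by
  induction p using MvPolynomial.induction_on' with
  | monomial m c =>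
    have hf : pderiv j (monomial (m.erase j) c) = 0 := by simp [pderiv_monomial]
    have hg : pderiv i (antideriv j (monomial (Finsupp.single j (m j)) (1 : K))) = 0 := by
      rw [pderiv_antideriv_of_ne hij.symm, pderiv_monomial]
      simp [hij]
    refine ⟨_, (fixedD φ).lie_mem (smul_pderiv_mem_fixedD hφ hf) (smul_pderiv_mem_fixedD hφ hg),
      ?_, fun k hki hkj => ?_⟩
    · rw [Derivation.commutator_apply]
      simp only [Derivation.smul_apply, pderiv_X_self, pderiv_X_of_ne hij, smul_eq_mul, mul_one,
        mul_zero, map_zero, sub_zero, pderiv_antideriv_self, monomial_mul, Finsupp.erase_add_single]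
    · rw [Derivation.commutator_apply]
      simp [pderiv_X_of_ne hki, pderiv_X_of_ne hkj]
  | add p q hp hq =>
    obtain ⟨d, hd, hdi, hdk⟩ := hp
    obtain ⟨e, he, hei, hek⟩ := hq
    exact ⟨d + e, add_mem hd he, by rw [Derivation.add_apply, hdi, hei], fun k h1 h2 => by
      rw [Derivation.add_apply, hdk k h1 h2, hek k h1 h2, add_zero]⟩

/-- An automorphism that fixes the partial derivatives and a diagonal field with weights in
general position is the identity. -/
theorem eq_one_of_fixed [CharZero K] [Nontrivial (Fin n)] (hd : ∀ i, φ (vf i 1) = vf i 1)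
    {w : Fin n → K} {hw : ∑ i, w i = 0} (hgen : ∀ i j k, w i - w j + w k ≠ 0)
    (hH : φ (diag w hw) = diag w hw) : φ = 1 := by
  have hφ : ∀ (j : Fin n) (m : Fin n →₀ ℕ), m j = 0 →
      φ (vf j (monomial m 1)) = vf j (monomial m 1) := fun j m hm =>
    map_vf_monomial_eq hd (fun i j hij => map_shear_eq hd hgen hH hij) m hm
  obtain ⟨j⟩ : Nonempty (Fin n) := inferInstance
  refine LieEquiv.ext fun x => coe_mem_fixedD.1 ?_
  choose! d hd hdi hdk using fun i (hi : i ≠ j) =>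
    exists_mem_fixedD hφ hi ((x : D K n) (X i))
  set s : D K n := ∑ i ∈ Finset.univ.erase j, d i with hs
  have hsmem : s ∈ fixedD φ := sum_mem fun i hi => hd i (Finset.ne_of_mem_erase hi)
  have hsx : ∀ i, i ≠ j → s (X i) = (x : D K n) (X i) := by
    intro i hi
    rw [hs, ← Derivation.coeFnAddMonoidHom_apply, map_sum, Finset.sum_apply,
      Finset.sum_eq_single i]
    · exact hdi i hi
    · exact fun k hk hki => hdk k (Finset.ne_of_mem_erase hk) i (Ne.symm hki) hi
    · exact fun h => absurd (Finset.mem_erase.2 ⟨hi, Finset.mem_univ i⟩) h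
  -- All coefficients but the j-th now agree; divergence zero makes the remaining one independent of
  -- x_j, so the remainder is fixed too.
  have hrest : (x : D K n) - s = (((x : D K n) - s) (X j)) • (pderiv j : D K n) := by
    refine derivation_ext fun i => ?_
    rw [Derivation.smul_apply, pderiv_X, Pi.single_apply]
    split_ifs with hi
    · rw [hi, smul_eq_mul, mul_one]
    · rw [Derivation.sub_apply, hsx i hi, sub_self, smul_zero]
  have hdiv : pderiv j (((x : D K n) - s) (X j)) = 0 := by
    have h1 : divergence ((x : D K n) - s) = 0 := sub_mem x.2 hsmem.1
    rw [divergence, Finset.sum_eq_single j] at h1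
    · exact h1
    · intro i _ hi
      rw [Derivation.sub_apply, hsx i hi, sub_self, map_zero]
    · exact fun h => absurd (Finset.mem_univ j) h
  have := add_mem (smul_pderiv_mem_fixedD hφ hdiv) hsmem
  rwa [← hrest, sub_add_cancel] at this

end Rigidity

/-! ### The isomorphism in at least two variables. -/

/-- If σ commutes with ∂_i and x_j ∂_i, then ∂_i(σ x_i) = 1, and x_j ∂_i applied to σ x_i gives both
x_j and σ x_j. -/
theorem conj_injective [Nontrivial (Fin n)] : Function.Injective (conj K n) := by
  rw [injective_iff_map_eq_one]
  intro σ hσ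
  have h : ∀ (x : divZero K n) (p : P K n), (x : D K n) (σ p) = σ ((x : D K n) p) := by
    intro x p
    rw [← conjD_apply_map, ← coe_conj, hσ]
    rfl
  refine AlgEquiv.coe_toAlgHom_injective (algHom_ext fun j => ?_)
  obtain ⟨i, hi⟩ := exists_ne j
  have h1 := h (vf i 1) (X i)
  have h2 := h (vf i (X j)) (X i)
  rw [coe_vf_one, pderiv_X_self, map_one] at h1
  rw [coe_vf_X hi.symm, Derivation.smul_apply, Derivation.smul_apply, h1, pderiv_X_self,
    smul_eq_mul, mul_one] at h2
  exact h2.symm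

theorem conj_surjective [CharZero K] [Nontrivial (Fin n)] : Function.Surjective (conj K n) := by
  intro φ
  obtain ⟨w, hw, hgen⟩ := exists_weights (K := K) (n := n)
  obtain ⟨σ, hσ, hσ'⟩ := exists_conj_eq φ hw fun i => by
    have := hgen i i i
    rwa [sub_self, zero_add] at this
  refine ⟨σ, ?_⟩
  have h : ∀ x, conj K n σ x = φ x → ((conj K n σ)⁻¹ * φ) x = x := by
    intro x hx
    change (conj K n σ).symm (φ x) = x
    rw [← hx]
    exact (conj K n σ).symm_apply_apply x
  exact inv_mul_eq_one.1 (eq_one_of_fixed (fun i => h _ (hσ i)) hgen (h _ hσ'))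

/-! ### The case of one variable. -/

section OneVariable

theorem exists_eq_smul_vf_one [CharZero K] (x : divZero K 1) : ∃ c : K, x = c • vf 0 1 := by
  have hx : divergence (x : D K 1) = 0 := x.2
  rw [divergence, Fin.sum_univ_one] at hx
  have hC := eq_C_of_pderiv_eq_zero (p := (x : D K 1) (X 0)) fun i => by
    rwa [Subsingleton.elim i 0]
  refine ⟨coeff 0 ((x : D K 1) (X 0)), Subtype.ext (derivation_ext fun i => ?_)⟩
  rw [Subsingleton.elim i 0, SetLike.val_smul, coe_vf_one, Derivation.smul_apply, pderiv_X_self,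
    ← C_1, smul_eq_C_mul, ← C_mul, mul_one]
  exact hC

theorem lie_eq_zero [CharZero K] (x y : divZero K 1) : ⁅x, y⁆ = 0 := by
  obtain ⟨a, rfl⟩ := exists_eq_smul_vf_one x
  obtain ⟨b, rfl⟩ := exists_eq_smul_vf_one y
  rw [smul_lie, lie_smul, lie_self, smul_zero, smul_zero]

theorem lieAut_ext_one [CharZero K] {φ ψ : LieAut K (divZero K 1)}
    (h : φ (vf 0 1) = ψ (vf 0 1)) : φ = ψ := by
  refine LieEquiv.ext fun x => ?_
  obtain ⟨c, rfl⟩ := exists_eq_smul_vf_one x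
  rw [map_smul, map_smul, h]

/-- The automorphisms of the one-dimensional Lie algebra given by nonzero scalars. -/
noncomputable def scalarAut [CharZero K] : Kˣ →* LieAut K (divZero K 1) where
  toFun c :=
    { toFun x := (c : K) • x
      invFun x := ((c⁻¹ : Kˣ) : K) • x
      map_add' x y := smul_add _ x y
      map_smul' a x := smul_comm _ a x
      map_lie' {x y} := by
        rw [lie_eq_zero, lie_eq_zero, smul_zero]
      left_inv x := by simp [smul_smul]
      right_inv x := by simp [smul_smul] }
  map_one' := LieEquiv.ext fun x => one_smul K x
  map_mul' a b := LieEquiv.ext fun x => mul_smul (a : K) (b : K) x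

theorem scalarAut_apply [CharZero K] (c : Kˣ) (x : divZero K 1) : scalarAut c x = (c : K) • x := rfl

theorem exists_unit_map_vf_one [CharZero K] (φ : LieAut K (divZero K 1)) :
    ∃ c : Kˣ, φ (vf 0 1) = (c : K) • vf 0 1 := by
  obtain ⟨c, hc⟩ := exists_eq_smul_vf_one (φ (vf 0 1))
  refine ⟨Units.mk0 c ?_, hc⟩
  rintro rfl
  rw [zero_smul] at hc
  refine vf_one_ne_zero (K := K) (0 : Fin 1) (φ.injective ?_)
  change φ (vf 0 1) = φ 0
  rw [hc, map_zero]

theorem scalarAut_bijective [CharZero K] :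
    Function.Bijective (scalarAut : Kˣ →* LieAut K (divZero K 1)) := by
  constructor
  · intro a b h
    have h1 : (a : K) • (vf 0 1 : divZero K 1) = (b : K) • vf 0 1 := by
      rw [← scalarAut_apply, ← scalarAut_apply, h]
    exact Units.ext (smul_left_injective K (vf_one_ne_zero 0) h1)
  · intro φ
    obtain ⟨c, hc⟩ := exists_unit_map_vf_one φ
    exact ⟨c, lieAut_ext_one hc.symm⟩

/-- The scaling automorphism `x ↦ c x`. -/
noncomputable def scaling (c : Kˣ) : G K 1 :=
  AlgEquiv.ofAlgHom (aeval fun i => (c : K) • X i) (aeval fun i => ((c⁻¹ : Kˣ) : K) • X i)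
    (algHom_ext fun i => by simp [smul_smul]) (algHom_ext fun i => by simp [smul_smul])

theorem scaling_X (c : Kˣ) (i : Fin 1) : scaling c (X i) = (c : K) • X i :=
  aeval_X (fun i => (c : K) • (X i : P K 1)) i

theorem conj_one_surjective [CharZero K] : Function.Surjective (conj K 1) := by
  intro φ
  obtain ⟨c, hc⟩ := exists_unit_map_vf_one φ
  -- Conjugation by x ↦ cx multiplies ∂ by c⁻¹, hence the inverse.
  refine ⟨scaling c⁻¹, lieAut_ext_one (Subtype.ext (derivation_ext fun i => ?_))⟩
  have h1 := conjD_apply_map (scaling c⁻¹) (pderiv i : D K 1) (X i)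
  rw [scaling_X, pderiv_X_self, map_one, Derivation.map_smul] at h1
  rw [hc, coe_conj, SetLike.val_smul, coe_vf_one, Derivation.smul_apply, Subsingleton.elim 0 i,
    pderiv_X_self, ← h1, smul_smul, Units.mul_inv, one_smul]

theorem ker_conj_one [CharZero K] : (conj K 1).ker = Sh K 1 := by
  ext σ
  rw [MonoidHom.mem_ker]
  constructor
  · intro hσ
    have h1 := conjD_apply_map σ (vf 0 1 : divZero K 1) (X 0)
    rw [← coe_conj, hσ] at h1
    change (vf 0 1 : divZero K 1).1 _ = _ at h1
    rw [coe_vf_one, pderiv_X_self, map_one] at h1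
    have h2 := eq_C_of_pderiv_eq_zero (p := σ (X 0) - X 0) fun i => by
      rw [Subsingleton.elim i 0, map_sub, h1, pderiv_X_self, sub_self]
    refine ⟨fun _ => coeff 0 (σ (X 0) - X 0), fun i => ?_⟩
    rw [Subsingleton.elim i 0, ← h2, add_sub_cancel]
  · rintro ⟨c, hc⟩
    -- Conjugating by σ⁻¹ instead evaluates the derivation at σ x, which the shift condition
    -- describes.
    rw [← inv_eq_one, ← map_inv]
    refine lieAut_ext_one (Subtype.ext (derivation_ext fun i => ?_))
    rw [coe_conj, coe_vf_one, conjD_apply, inv_inv, hc, Subsingleton.elim i 0, map_add,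
      pderiv_X_self, pderiv_C, add_zero, map_one]
    change 1 = (vf 0 1 : divZero K 1).1 (X 0)
    rw [coe_vf_one, pderiv_X_self]

end OneVariable

end PolyVect

theorem theorem1p1 (K : Type*) [Field K] [CharZero K] :
    (∀ n : ℕ, 2 ≤ n →
      ∃ e : PolyVect.G K n ≃* PolyVect.LieAut K (PolyVect.divZero K n),
        ∀ (σ : PolyVect.G K n) (d : PolyVect.divZero K n) (p : PolyVect.P K n),
          (e σ d : PolyVect.D K n) p = σ ((d : PolyVect.D K n) (σ⁻¹ p))) ∧
    (∃ _ : (PolyVect.Sh K 1).Normal,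
      (∃ e : (PolyVect.G K 1 ⧸ PolyVect.Sh K 1) ≃* PolyVect.LieAut K (PolyVect.divZero K 1),
        ∀ (σ : PolyVect.G K 1) (d : PolyVect.divZero K 1) (p : PolyVect.P K 1),
          (e (QuotientGroup.mk σ) d : PolyVect.D K 1) p
            = σ ((d : PolyVect.D K 1) (σ⁻¹ p))) ∧
      Nonempty ((PolyVect.G K 1 ⧸ PolyVect.Sh K 1) ≃* Kˣ)) := by
  constructor
  · intro n hn
    have : Nontrivial (Fin n) := Fin.nontrivial_iff_two_le.2 hn
    exact ⟨MulEquiv.ofBijective (PolyVect.conj K n)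
      ⟨PolyVect.conj_injective, PolyVect.conj_surjective⟩, fun _ _ _ => rfl⟩
  · have hN : (PolyVect.Sh K 1).Normal := by
      rw [← PolyVect.ker_conj_one]
      infer_instance
    let e : (PolyVect.G K 1 ⧸ PolyVect.Sh K 1) ≃* PolyVect.LieAut K (PolyVect.divZero K 1) :=
      (QuotientGroup.quotientMulEquivOfEq PolyVect.ker_conj_one.symm).trans
        (QuotientGroup.quotientKerEquivOfSurjective (PolyVect.conj K 1)
          PolyVect.conj_one_surjective)
    exact ⟨hN, ⟨e, fun _ _ _ => rfl⟩,
      ⟨e.trans (MulEquiv.ofBijective _ PolyVect.scalarAut_bijective).symm⟩⟩
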